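/- Let $q=2$, let $A=\mathbb F_2[\theta]$, $K=\mathbb F_2(\theta)$, and let $K_\infty=\mathbb F_2((1/\theta))$ be the completion of $K$ at the infinite place. For integers $d\ge 0$ and $s\ge 1$ put $S_d(s)=\sum_a a^{-s}$, the sum over the monic $a\in A$ of degree $d$, and for positive integers $s_1,\dots,s_r$ let $$\zeta_A(s_1,\dots,s_r)=\sum_{d_1>\cdots>d_r\ge 0}S_{d_1}(s_1)\cdots S_{d_r}(s_r)\in K_\infty .$$ Let $[n]=\theta^{2^n}-\theta$, let $L_n=[n][n-1]\cdots[1]$ (so $L_0=1$), and let $\tilde\pi=(-\theta)^2\prod_{i\ge1}\bigl(1-\theta/\theta^{2^i}\bigr)^{-1}\in K_\infty$ be the fundamental period of the Carlitz module. These series and this product converge, and for every integer $r>1$ $$\zeta_A(1)\,\zeta_A(1,2,2^2,\dots,2^{r-1})=\zeta_A(1,3,2^2,\dots,2^{r-1})+\zeta_A(1,1,2,\dots,2^{r-2})^2 ,$$ where each of the three tuples has depth $r$ (for $r=2$ they are $(1,2)$, $(1,3)$, $(1,1)$). Furthermore, with $$c_r=\frac{[r]-1}{L_1[r]}\cdot\frac{1}{\Bigl(\prod_{i=1}^{r-3}L_i^{2^{r-1-i}}\Bigr)L_{r-2}^{2^2}}=\frac{[r]-1}{L_1[r]}\cdot\frac{1}{L_1^{2^{r-2}}L_2^{2^{r-3}}\cdots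 L_{r-3}^{2^2}L_{r-2}^{2^2}}\in K$$ (an empty product is $1$; the last factor $L_{r-2}^{2^2}$ is $1$ for $r=2$ and is the only factor $L_1^{4}$ for $r=3$), one has $$\zeta_A(1,3,2^2,\dots,2^{r-1})=\frac{c_r}{L_1^{2^r}}\,\tilde\pi^{2^r}=c_r\,\zeta_A(2^r).$$ In particular $\zeta_A(1,3,2^2,\dots,2^{r-1})$, whose weight is $2^r$, is Eulerian: its ratio to $\tilde\pi^{2^r}$ lies in $K$. -/

import Mathlib

namespace FunctionFieldMZV

open Polynomial

noncomputable section

variable (Fq : Type*) [Field Fq]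

/-- `K = 𝔽_q(θ)`, the field of rational functions. -/
abbrev K : Type _ := RatFunc Fq

open scoped Classical in
/-- `K_∞ = 𝔽_q((1/θ))`, the completion of `K` at the infinite place `1/θ`. -/
abbrev KInfty : Type _ := RatFunc.CompletionAtInfty Fq

/-- The variable `θ` as an element of `K`. -/
def theta : K Fq := RatFunc.X

/-- The set of monic polynomials of degree `d` over a finite field is finite. -/
theorem finite_monic_natDegree [Finite Fq] (d : ℕ) :
    {a : Fq[X] | a.Monic ∧ a.natDegree = d}.Finite := by
  refine Set.Finite.of_finite_image (f := fun a : Fq[X] => fun i : Fin (d + 1) => a.coeff i)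
    (Set.toFinite _) ?_
  rintro a ⟨-, ha⟩ b ⟨-, hb⟩ hab
  ext n
  by_cases hn : n < d + 1
  · exact congrFun hab ⟨n, hn⟩
  · rw [coeff_eq_zero_of_natDegree_lt (by omega), coeff_eq_zero_of_natDegree_lt (by omega)]

/-- `A_{d+}`, the monic polynomials of degree `d` in `A = 𝔽_q[θ]`. -/
def monicsOfDegree [Finite Fq] (d : ℕ) : Finset Fq[X] :=
  (finite_monic_natDegree Fq d).toFinset

/-- The power sum `S_d(s) = ∑_{a ∈ A_{d+}} 1 / a ^ s ∈ K`. -/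
def powerSum [Finite Fq] (d s : ℕ) : K Fq :=
  ∑ a ∈ monicsOfDegree Fq d, 1 / (algebraMap Fq[X] (K Fq) a) ^ s

/-- The term `S_{d₁}(s₁) ⋯ S_{d_r}(s_r)`, viewed in `K_∞`, attached to degrees
`d₁ > ⋯ > d_r ≥ 0`. -/
def multizetaTerm [Finite Fq] {r : ℕ} (s : Fin r → ℕ) (d : {d : Fin r → ℕ // StrictAnti d}) :
    KInfty Fq :=
  algebraMap (K Fq) (KInfty Fq) (∏ i, powerSum Fq (d.1 i) (s i))

/-- The multizeta value
`ζ_A(s₁, …, s_r) = ∑_{d₁ > ⋯ > d_r ≥ 0} S_{d₁}(s₁) ⋯ S_{d_r}(s_r) ∈ K_∞`. -/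
def multizeta [Finite Fq] {r : ℕ} (s : Fin r → ℕ) : KInfty Fq :=
  ∑' d, multizetaTerm Fq s d

/-- `[n] = θ^{q^n} - θ`. -/
def bracket (n : ℕ) : K Fq :=
  theta Fq ^ (Nat.card Fq) ^ n - theta Fq

/-- `L_n = [n][n-1]⋯[1]`, with `L_0 = 1`. -/
def carlitzL (n : ℕ) : K Fq :=
  ∏ i ∈ Finset.Icc 1 n, bracket Fq i

/-- The `i`-th factor `(1 - θ / θ^{2^{i+1}})⁻¹` (counted from `i = 0`) in the product formula for
the period of the Carlitz module when `q = 2`. -/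
def periodFactor (i : ℕ) : KInfty Fq :=
  algebraMap (K Fq) (KInfty Fq) (1 - theta Fq / theta Fq ^ 2 ^ (i + 1))⁻¹

/-- The fundamental period `π̃ = (-θ)^{q/(q-1)} ∏_{i ≥ 1} (1 - θ / θ^{q^i})⁻¹` of the Carlitz module
in the case `q = 2`, where `q/(q-1) = 2` and where `π̃` lies in `K_∞`. -/
def carlitzPeriodTwo : KInfty Fq :=
  algebraMap (K Fq) (KInfty Fq) ((-theta Fq) ^ 2) * ∏' i, periodFactor Fq i

/-- For `q = 2`: the multizeta value `ζ_A(s₁, …, s_r)` of weight `w = s₁ + ⋯ + s_r` is Eulerian,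
i.e. `ζ_A(s₁, …, s_r) / π̃ ^ w` lies in `K`. -/
def IsEulerianTwo [Finite Fq] {r : ℕ} (s : Fin r → ℕ) : Prop :=
  ∃ c : K Fq, multizeta Fq s / carlitzPeriodTwo Fq ^ (∑ i, s i) =
    algebraMap (K Fq) (KInfty Fq) c

/-- The tuple `(1, 2, 2², …, 2^{r-1})`. -/
def tuplePow (r : ℕ) : Fin r → ℕ := fun i => 2 ^ (i : ℕ)

/-- The tuple `(1, 3, 2², …, 2^{r-1})`. -/
def tupleThree (r : ℕ) : Fin r → ℕ := fun i => if (i : ℕ) = 1 then 3 else 2 ^ (i : ℕ)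

/-- The tuple `(1, 1, 2, …, 2^{r-2})`. -/
def tupleOneOne (r : ℕ) : Fin r → ℕ := fun i => if (i : ℕ) = 0 then 1 else 2 ^ ((i : ℕ) - 1)

/-- The element
`([r] - 1) / (L_1 [r]) · 1 / (L_1^{2^{r-2}} L_2^{2^{r-3}} ⋯ L_{r-3}^{2^2} L_{r-2}^{2^2})` of `K`,
for `r ≥ 2`; the exponent of `L_i` is `2^{r-1-i}` for `1 ≤ i ≤ r - 3` and `2^2` for `i = r - 2`. -/
def eulerCoeff (r : ℕ) : K Fq :=
  (bracket Fq r - 1) / (carlitzL Fq 1 * bracket Fq r) *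
    (1 / ((∏ i ∈ Finset.Ico 1 (r - 2), carlitzL Fq i ^ 2 ^ (r - 1 - i)) *
      carlitzL Fq (r - 2) ^ 2 ^ 2))

end

end FunctionFieldMZV

namespace FunctionFieldMZV

open Polynomial Filter Topology

noncomputable section

/-! Write T_s(N) for the sum over N > d₁ > ⋯ > d_r ≥ 0, so that T_s(N+1) = T_s(N) + S_N(s₁) T_{tail
s}(N). For q = 2 one has S_N(1) = 1/L_N and S_N(2s) = S_N(s)², and the additivity of the polynomial
E_N = ∏ (X + a) over deg a < N gives S_N(3) = S_N(2) T_{(1)}(N+1). With these inputs the depth r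
relation already holds for every truncation N: induction on N works because the unwanted cross terms
occur twice and vanish in characteristic 2 (`truncatedMZV_relation`).

The truncations also have closed forms: T_{(1)}(N) = [N]²/([1] L_N), T_{(1,2,…,2^{n-1})}(M+n) =
L_{M+n}/(D_n L_M^{2^n}), T_{(1,1,2,…,2^{n-1})}(M+n) = T_{(1)}(M)^{2^n}/D_n. In the limit they give
π̃ = L_1 ζ(1), ζ(1,2,…,2^{n-1}) = π̃^{2^n-1}/D_n and ζ(1,1,2,…,2^{n-1}) = ζ(1)^{2^n}/D_n.

Substituted in the relation, these give ζ(1,3,4,…) = (L_1^{2^r-1}/D_r − 1/D_{r-1}²) ζ(1)^{2^r}. The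
bracket is c_r (`eulerCoeff_eq`), and ζ(1)^{2^r} = ζ(2^r) by Frobenius. -/

/-! ### Convergence in K_∞. -/

open scoped Classical in
theorem valued_algebraMap (F : Type*) [Field F] (x : K F) :
    Valued.v (algebraMap (K F) (KInfty F) x) = RatFunc.inftyValuation F x :=
  @Valued.valuedCompletion_apply _ _ _ _ (RatFunc.inftyValued F) x

instance completeSpace_kInfty (F : Type*) [Field F] : CompleteSpace (KInfty F) := by
  classical
  let _ := (RatFunc.inftyValued F).toUniformSpace
  exact inferInstanceAs (CompleteSpace (UniformSpace.Completion (RatFunc F)))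

theorem exists_exp_lt_subset_of_mem_nhds_zero {F : Type*} [Field F] {U : Set (KInfty F)}
    (hU : U ∈ 𝓝 (0 : KInfty F)) :
    ∃ n : ℤ, {x : KInfty F | Valued.v x < WithZero.exp n} ⊆ U := by
  obtain ⟨γ, hγ⟩ := Valued.mem_nhds_zero.1 hU
  have hne : MonoidWithZeroHom.ValueGroup₀.embedding γ.1 ≠ 0 := by simp
  refine ⟨WithZero.log (MonoidWithZeroHom.ValueGroup₀.embedding γ.1), fun x hx => hγ ?_⟩
  rw [Set.mem_ofPred_eq, WithZero.exp_log hne] at hx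
  exact (Valuation.restrict_lt_iff_lt_embedding _).2 hx

instance nonarchimedeanRing_kInfty (F : Type*) [Field F] : NonarchimedeanRing (KInfty F) where
  is_nonarchimedean U hU := by
    obtain ⟨γ, hγ⟩ := Valued.mem_nhds_zero.1 hU
    refine ⟨⟨(Valued.v.restrict).ltAddSubgroup γ, ?_⟩, hγ⟩
    exact Valued.isOpen_ball _ _

/-- A family whose valuations are dominated by a proper function tends to zero. -/
theorem tendsto_zero_of_valued_le_exp_neg {F ι : Type*} [Field F] {f : ι → KInfty F} (g : ι → ℕ)
    (hg : ∀ N, {i | g i ≤ N}.Finite) (hf : ∀ i, Valued.v (f i) ≤ WithZero.exp (-(g i : ℤ))) :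
    Tendsto f cofinite (𝓝 0) := by
  intro U hU
  obtain ⟨n, hn⟩ := exists_exp_lt_subset_of_mem_nhds_zero hU
  rw [mem_map, mem_cofinite]
  refine (hg (-n).toNat).subset fun i hi => ?_
  by_contra h
  refine hi (hn ((hf i).trans_lt ?_))
  simp only [Set.mem_ofPred_eq, not_le] at h
  rw [WithZero.exp_lt_exp]
  omega

/-- K_∞ is complete and nonarchimedean, so terms tending to zero along `cofinite` suffice. -/
theorem summable_of_valued_le_exp_neg {F ι : Type*} [Field F] {f : ι → KInfty F} (g : ι → ℕ)
    (hg : ∀ N, {i | g i ≤ N}.Finite) (hf : ∀ i, Valued.v (f i) ≤ WithZero.exp (-(g i : ℤ))) :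
    Summable f :=
  NonarchimedeanAddGroup.summable_of_tendsto_cofinite_zero
    (tendsto_zero_of_valued_le_exp_neg g hg hf)

theorem mem_monicsOfDegree {F : Type*} [Field F] [Finite F] {d : ℕ} {a : F[X]} :
    a ∈ monicsOfDegree F d ↔ a.Monic ∧ a.natDegree = d := by
  simp [monicsOfDegree]

theorem inftyValuation_powerSum_le (F : Type*) [Field F] [Finite F] (d : ℕ) {s : ℕ} (hs : 0 < s) :
    open scoped Classical in
    RatFunc.inftyValuation F (powerSum F d s) ≤ WithZero.exp (-(d : ℤ)) := by
  classical
  refine Valuation.map_sum_le _ fun a ha => ?_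
  obtain ⟨ha, hd⟩ := mem_monicsOfDegree.1 ha
  rw [map_div₀, map_one, map_pow, RatFunc.inftyValuation_apply,
    RatFunc.inftyValuation.polynomial F ha.ne_zero, hd, ← WithZero.exp_nsmul, one_div,
    ← WithZero.exp_neg, WithZero.exp_le_exp]
  have : (d : ℤ) ≤ s * d := le_mul_of_one_le_left (by positivity) (by exact_mod_cast hs)
  simpa using this

theorem summable_multizetaTerm (F : Type*) [Field F] [Finite F] (n : ℕ) (s : Fin n → ℕ)
    (hs : ∀ i, 0 < s i) : Summable (multizetaTerm F s) := by
  classical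
  cases n with
  | zero => exact Summable.of_finite
  | succ n =>
    -- The first entry is the largest degree: it bounds the whole tuple, which gives finiteness, and
    -- its power sum alone gives the decay.
    refine summable_of_valued_le_exp_neg (fun d => d.1 0) (fun N => ?_) fun d => ?_
    · refine Set.Finite.of_finite_image (f := Subtype.val) ?_ Subtype.val_injective.injOn
      refine (Set.Finite.pi' fun _ : Fin (n + 1) => Set.finite_Iic N).subset ?_
      rintro _ ⟨d, hd, rfl⟩ i
      exact (d.2.antitone (Fin.zero_le i)).trans hd
    · rw [multizetaTerm, valued_algebraMap, map_prod, Fin.prod_univ_succ]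
      refine (mul_le_of_le_one_right' (Finset.prod_le_one' fun i _ => ?_)).trans
        (inftyValuation_powerSum_le F _ (hs 0))
      refine (inftyValuation_powerSum_le F _ (hs _)).trans ?_
      rw [← WithZero.exp_zero, WithZero.exp_le_exp]
      simp

theorem multipliable_periodFactor (F : Type*) [Field F] : Multipliable (periodFactor F) := by
  classical
  have hX : ∀ i : ℕ, RatFunc.inftyValuation F (theta F / theta F ^ 2 ^ (i + 1)) =
      WithZero.exp (1 - 2 ^ (i + 1)) := fun i => by
    rw [map_div₀, map_pow, theta, RatFunc.inftyValuation.X, ← WithZero.exp_nsmul,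
      ← WithZero.exp_sub]
    simp
  have hlt : ∀ i : ℕ, ((i : ℤ) + 1) ≤ 2 ^ (i + 1) - 1 := fun i => by
    have := Nat.lt_two_pow_self (n := i + 1)
    zify at this
    linarith
  have hX' : ∀ i : ℕ, RatFunc.inftyValuation F (theta F / theta F ^ 2 ^ (i + 1)) < 1 := fun i => by
    rw [hX, ← WithZero.exp_zero, WithZero.exp_lt_exp]
    have := hlt i
    omega
  have hv : ∀ i, Valued.v (periodFactor F i - 1) ≤ WithZero.exp (-((i : ℤ) + 1)) := fun i => by
    have h1 : RatFunc.inftyValuation F (1 - theta F / theta F ^ 2 ^ (i + 1)) = 1 :=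
      Valuation.map_one_sub_of_lt _ (hX' i)
    have h0 : (1 - theta F / theta F ^ 2 ^ (i + 1)) ≠ 0 := fun h => by simp [h] at h1
    have : (1 - theta F / theta F ^ 2 ^ (i + 1))⁻¹ - 1 =
        (theta F / theta F ^ 2 ^ (i + 1)) * (1 - theta F / theta F ^ 2 ^ (i + 1))⁻¹ := by
      field_simp
      ring
    rw [periodFactor, ← map_one (algebraMap (K F) (KInfty F)), ← map_sub, valued_algebraMap, this,
      map_mul, map_inv₀, h1, hX, inv_one, mul_one, WithZero.exp_le_exp]
    have := hlt i
    omega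
  -- Every factor has valuation at most 1, so the one of largest index bounds the product. The empty
  -- set has `sup` 0 and product 1, which still meets the bound.
  have hprod : Summable fun s : Finset ℕ => ∏ i ∈ s, (periodFactor F i - 1) := by
    refine summable_of_valued_le_exp_neg (fun s => s.sup id) (fun N => ?_) fun s => ?_
    · refine (Finset.finite_toSet (Finset.range (N + 1)).powerset).subset fun s hs => ?_
      simp only [Finset.coe_powerset, Set.mem_preimage, Set.mem_powerset_iff, Finset.coe_subset]
      intro i hi
      exact Finset.mem_range_succ_iff.2 ((Finset.le_sup (f := id) hi).trans hs)
    · rw [map_prod]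
      rcases s.eq_empty_or_nonempty with rfl | hs
      · simp
      obtain ⟨j, hj, hjs⟩ := Finset.exists_mem_eq_sup s hs id
      rw [← Finset.mul_prod_erase s _ hj, hjs]
      refine (mul_le_of_le_one_right' (Finset.prod_le_one' fun i _ => (hv i).trans ?_)).trans
        ((hv j).trans ?_)
      · rw [← WithZero.exp_zero, WithZero.exp_le_exp]
        omega
      · rw [WithZero.exp_le_exp, id]
        omega
  simpa using multipliable_one_add_of_summable_prod hprod

/-! ### Truncated multizeta values and their limit. -/

/-- The strictly decreasing tuples with entries below `N`. -/
def boundedTuples (n N : ℕ) : Finset (Fin n → ℕ) :=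
  open scoped Classical in (Fintype.piFinset fun _ : Fin n => Finset.range N).filter StrictAnti

theorem mem_boundedTuples {n N : ℕ} {d : Fin n → ℕ} :
    d ∈ boundedTuples n N ↔ (∀ i, d i < N) ∧ StrictAnti d := by
  simp [boundedTuples]

theorem strictAnti_finCons_iff {n a : ℕ} {d : Fin n → ℕ} :
    StrictAnti (Fin.cons a d : Fin (n + 1) → ℕ) ↔ (∀ i, d i < a) ∧ StrictAnti d := by
  constructor
  · intro h
    exact ⟨fun i => by simpa using h (Fin.succ_pos i),
      fun i j hij => by simpa using h (Fin.succ_lt_succ_iff.2 hij)⟩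
  · rintro ⟨h, hd⟩ i j hij
    induction j using Fin.cases with
    | zero => exact absurd hij (Fin.not_lt_zero i)
    | succ j =>
      induction i using Fin.cases with
      | zero => simpa using h j
      | succ i => simpa using hd (Fin.succ_lt_succ_iff.1 hij)

theorem sum_boundedTuples_succ {M : Type*} [AddCommMonoid M] {n N : ℕ}
    (f : (Fin (n + 1) → ℕ) → M) :
    ∑ d ∈ boundedTuples (n + 1) N, f d =
      ∑ a ∈ Finset.range N, ∑ d ∈ boundedTuples n a, f (Fin.cons a d) := by
  rw [Finset.sum_sigma']
  refine Finset.sum_bij' (fun d _ => ⟨d 0, Fin.tail d⟩) (fun p _ => Fin.cons p.1 p.2)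
    ?_ ?_ ?_ ?_ ?_
  · intro d hd
    obtain ⟨h1, h2⟩ := mem_boundedTuples.1 hd
    rw [← Fin.cons_self_tail d] at h2
    exact Finset.mem_sigma.2
      ⟨Finset.mem_range.2 (h1 0), mem_boundedTuples.2 (strictAnti_finCons_iff.1 h2)⟩
  · rintro ⟨a, d⟩ hp
    obtain ⟨ha, hd⟩ := Finset.mem_sigma.1 hp
    have hd := mem_boundedTuples.1 hd
    have ha : a < N := Finset.mem_range.1 ha
    refine mem_boundedTuples.2 ⟨fun i => ?_, strictAnti_finCons_iff.2 hd⟩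
    induction i using Fin.cases with
    | zero => simpa using ha
    | succ i => simpa using (hd.1 i).trans ha
  · intro d _
    exact Fin.cons_self_tail d
  · rintro ⟨a, d⟩ _
    simp
  · intro d _
    rw [Fin.cons_self_tail]

/-- The truncation `∑_{N > d₁ > ⋯ > d_r ≥ 0} S_{d₁}(s₁) ⋯ S_{d_r}(s_r)` of a multizeta value. -/
def truncatedMZV (F : Type*) [Field F] [Finite F] : ∀ {n : ℕ}, (Fin n → ℕ) → ℕ → K F
  | 0, _, _ => 1
  | _ + 1, s, N => ∑ d ∈ Finset.range N, powerSum F d (s 0) * truncatedMZV F (Fin.tail s) d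

theorem truncatedMZV_eq_sum (F : Type*) [Field F] [Finite F] {n : ℕ} (s : Fin n → ℕ) (N : ℕ) :
    truncatedMZV F s N = ∑ d ∈ boundedTuples n N, ∏ i, powerSum F (d i) (s i) := by
  induction n generalizing N with
  | zero =>
    have : boundedTuples 0 N = Finset.univ := by
      ext d
      simpa [mem_boundedTuples, Subsingleton.strictAnti] using Subsingleton.elim _ _
    simp [truncatedMZV, this]
  | succ n ih =>
    rw [sum_boundedTuples_succ, truncatedMZV]
    refine Finset.sum_congr rfl fun a _ => ?_
    rw [ih, Finset.mul_sum]
    refine Finset.sum_congr rfl fun d _ => ?_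
    rw [Fin.prod_univ_succ]
    simp [Fin.tail]

/-- The sets `boundedTuples n N` increase with `N` and exhaust the index set, so the unconditional
sum is the limit along them. -/
theorem tendsto_truncatedMZV (F : Type*) [Field F] [Finite F] {n : ℕ} {s : Fin n → ℕ}
    (hs : ∀ i, 0 < s i) :
    Tendsto (fun N => algebraMap (K F) (KInfty F) (truncatedMZV F s N)) atTop
      (𝓝 (multizeta F s)) := by
  classical
  have hmono : Monotone fun N => (boundedTuples n N).subtype StrictAnti := fun a b hab d hd => by
    simp only [Finset.mem_subtype, mem_boundedTuples] at hd ⊢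
    exact ⟨fun i => (hd.1 i).trans_le hab, hd.2⟩
  have hex : ∀ d : {d : Fin n → ℕ // StrictAnti d},
      ∃ N, d ∈ (boundedTuples n N).subtype StrictAnti := fun d => by
    refine ⟨Finset.univ.sup d.1 + 1, ?_⟩
    simp only [Finset.mem_subtype, mem_boundedTuples]
    exact ⟨fun i => Nat.lt_succ_of_le (Finset.le_sup (Finset.mem_univ i)), d.2⟩
  refine ((summable_multizetaTerm F n s hs).hasSum.comp
    (tendsto_atTop_finset_of_monotone hmono hex)).congr fun N => ?_
  rw [truncatedMZV_eq_sum, map_sum]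
  simp only [Function.comp_apply, multizetaTerm]
  rw [Finset.sum_subtype_of_mem (p := StrictAnti)
    (fun d => algebraMap (K F) (KInfty F) (∏ i, powerSum F (d i) (s i)))
    fun d hd => (mem_boundedTuples.1 hd).2]

/-! ### The power sums S_d(1), S_d(3), S_d(2s) for q = 2. -/

/-- The k-th coefficient is the elementary symmetric function e_k of the `u i`; the last clause is
Newton's identity p₃ = e₁³ − 3e₁e₂ + 3e₃ read modulo 2. -/
theorem sum_inv_and_sum_inv_cube_of_prod {k ι : Type*} [Field k] [CharP k 2] (s : Finset ι)
    (u : ι → k) :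
    (∏ i ∈ s, (1 + C (u i) * X)).coeff 0 = 1 ∧
    (∏ i ∈ s, (1 + C (u i) * X)).coeff 1 = ∑ i ∈ s, u i ∧
    ∑ i ∈ s, u i ^ 3 = (∏ i ∈ s, (1 + C (u i) * X)).coeff 1 ^ 3 +
      (∏ i ∈ s, (1 + C (u i) * X)).coeff 1 * (∏ i ∈ s, (1 + C (u i) * X)).coeff 2 +
      (∏ i ∈ s, (1 + C (u i) * X)).coeff 3 := by
  classical
  induction s using Finset.induction_on with
  | empty => simp [coeff_one]
  | insert a s ha ih =>
    obtain ⟨h0, h1, h3⟩ := ih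
    simp only [Finset.prod_insert ha, Finset.sum_insert ha, add_mul, one_mul, mul_assoc, coeff_add,
      coeff_C_mul, coeff_X_mul, coeff_X_mul_zero]
    simp only [h0, h3, ← h1]
    generalize (∏ i ∈ s, (1 + C (u i) * X)).coeff 1 = e1
    generalize (∏ i ∈ s, (1 + C (u i) * X)).coeff 2 = e2
    generalize (∏ i ∈ s, (1 + C (u i) * X)).coeff 3 = e3
    have h2 : (2 : k) = 0 := CharTwo.two_eq_zero
    refine ⟨by simp, by ring, ?_⟩
    linear_combination (-2 * e1 ^ 2 * u a - 2 * e1 * u a ^ 2 - u a * e2) * h2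

/-- Carlitz's `D_n = [n] [n-1]^2 ⋯ [1]^{2^{n-1}}` for `q = 2`. -/
def carlitzD (F : Type*) [Field F] : ℕ → K F
  | 0 => 1
  | n + 1 => bracket F (n + 1) * carlitzD F n ^ 2

/-- For `q = 2`, the polynomial `∏ (X + a)` over the polynomials `a` of degree less than `d`. -/
def carlitzE (F : Type*) [Field F] : ℕ → (K F)[X]
  | 0 => X
  | d + 1 => carlitzE F d ^ 2 + C (carlitzD F d) * carlitzE F d

section

variable {F : Type*} [Field F]

theorem charP_two_of_card (hq : Nat.card F = 2) : CharP F 2 := by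
  have : Finite F := Nat.finite_of_card_ne_zero (by omega)
  have := Fintype.ofFinite F
  exact charP_of_card_eq_prime (by rwa [Fintype.card_eq_nat_card])

theorem charP_two_K (hq : Nat.card F = 2) : CharP (K F) 2 :=
  have := charP_two_of_card hq
  charP_of_injective_algebraMap (algebraMap F (K F)).injective 2

theorem eq_zero_or_one_of_card (hq : Nat.card F = 2) (x : F) : x = 0 ∨ x = 1 := by
  classical
  have : Finite F := Nat.finite_of_card_ne_zero (by omega)
  have := Fintype.ofFinite F
  by_contra! h
  have h3 : ({0, 1, x} : Finset F).card ≤ Fintype.card F := Finset.card_le_univ _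
  rw [Finset.card_eq_three.2 ⟨0, 1, x, zero_ne_one, h.1.symm, h.2.symm, rfl⟩,
    Fintype.card_eq_nat_card, hq] at h3
  omega

theorem bracket_zero : bracket F 0 = 0 := by simp [bracket]

theorem bracket_add (hq : Nat.card F = 2) (m n : ℕ) :
    bracket F (m + n) = bracket F m ^ 2 ^ n + bracket F n := by
  have := charP_two_K hq
  have h : ∀ x y : K F, (x - y) ^ 2 ^ n = x ^ 2 ^ n - y ^ 2 ^ n := fun x y =>
    sub_pow_char_pow x y n
  simp only [bracket, hq, h, ← pow_mul, ← pow_add]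
  ring

theorem bracket_ne_zero (hq : Nat.card F = 2) {n : ℕ} (hn : n ≠ 0) : bracket F n ≠ 0 := by
  have h : (X ^ 2 ^ n - X : F[X]) ≠ 0 :=
    FiniteField.X_pow_card_sub_X_ne_zero F (Nat.one_lt_two_pow hn)
  have h' := (map_ne_zero_iff _ (RatFunc.algebraMap_injective F)).2 h
  simpa [bracket, hq, theta] using h'

theorem carlitzL_succ (n : ℕ) : carlitzL F (n + 1) = bracket F (n + 1) * carlitzL F n := by
  rw [carlitzL, Finset.prod_Icc_succ_top (by omega), mul_comm, carlitzL]

theorem carlitzL_zero : carlitzL F 0 = 1 := by simp [carlitzL]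

theorem carlitzL_one : carlitzL F 1 = bracket F 1 := by simp [carlitzL]

theorem carlitzL_ne_zero (hq : Nat.card F = 2) (n : ℕ) : carlitzL F n ≠ 0 :=
  Finset.prod_ne_zero_iff.2 fun i hi => bracket_ne_zero hq (by have := Finset.mem_Icc.1 hi; omega)

theorem carlitzD_ne_zero (hq : Nat.card F = 2) (n : ℕ) : carlitzD F n ≠ 0 := by
  induction n with
  | zero => exact one_ne_zero
  | succ n ih => exact mul_ne_zero (bracket_ne_zero hq n.succ_ne_zero) (pow_ne_zero 2 ih)

/-- Additivity of E_d: each step of the recursion combines squaring and scaling, both additive in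
characteristic 2. -/
theorem carlitzE_comp_X_add_C (hq : Nat.card F = 2) (d : ℕ) (t : K F) :
    (carlitzE F d).comp (X + C t) = carlitzE F d + C ((carlitzE F d).eval t) := by
  have := charP_two_K hq
  induction d with
  | zero => simp [carlitzE]
  | succ d ih =>
    simp only [carlitzE, add_comp, pow_comp, mul_comp, C_comp, ih, eval_add, eval_pow, eval_mul,
      eval_C, CharTwo.add_sq, C_add, C_mul, C_pow]
    ring

/-- Measures the failure of E_{d+1} to commute with multiplication by θ. At t = θ^d it yields
E_{d+1}(θ^{d+1}) = D_{d+1}. -/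
theorem carlitzE_eval_theta_mul (hq : Nat.card F = 2) (d : ℕ) (t : K F) :
    (carlitzE F (d + 1)).eval (theta F * t) =
      theta F * (carlitzE F (d + 1)).eval t + bracket F (d + 1) * (carlitzE F d).eval t ^ 2 := by
  have := charP_two_K hq
  have h2 : (2 : K F) = 0 := CharTwo.two_eq_zero
  induction d with
  | zero =>
    simp only [carlitzE, carlitzD, bracket, hq, eval_add, eval_pow, eval_mul, eval_C, eval_X]
    ring
  | succ d ih =>
    rw [carlitzE]
    simp only [eval_add, eval_pow, eval_mul, eval_C, ih]
    have hE : (carlitzE F (d + 1)).eval t =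
        (carlitzE F d).eval t ^ 2 + carlitzD F d * (carlitzE F d).eval t := by
      simp [carlitzE]
    have hb := bracket_add hq (d + 1) 1
    have hb1 : bracket F 1 = theta F ^ 2 + theta F := by
      simp [bracket, hq, CharTwo.sub_eq_add]
    rw [hb, pow_one, hb1, show carlitzD F (d + 1) = bracket F (d + 1) * carlitzD F d ^ 2 from rfl, hE]
    generalize bracket F (d + 1) = b
    generalize (carlitzE F d).eval t = e
    generalize carlitzD F d = D
    generalize theta F = T
    linear_combination (-b ^ 2 * D * e ^ 3 + T * (e ^ 2 + D * e) * b * e ^ 2 -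
      T * (e ^ 2 + D * e) ^ 2) * h2

theorem carlitzE_eval_theta_pow (hq : Nat.card F = 2) (d : ℕ) :
    (carlitzE F d).eval (theta F ^ d) = carlitzD F d := by
  have := charP_two_K hq
  induction d with
  | zero => simp [carlitzE, carlitzD]
  | succ d ih =>
    rw [pow_succ', carlitzE_eval_theta_mul hq, ih, carlitzE]
    simp only [eval_add, eval_pow, eval_mul, eval_C, ih, carlitzD]
    -- θ^d is a root of E_{d+1}, since E_{d+1}(θ^d) = D_d² + D_d² = 0; only [d+1] D_d² remains.
    rw [← sq, CharTwo.add_self_eq_zero, mul_zero, zero_add]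

/-- The vanishing third coefficient reflects additivity: only exponents that are powers of 2 occur.
For d = 0 the second coefficient is covered because [0] = 0; its inductive step is [d+1] = [d]² +
[1]. -/
theorem carlitzE_coeff (hq : Nat.card F = 2) (d : ℕ) :
    (carlitzE F d).coeff 0 = 0 ∧ (carlitzE F d).coeff 1 = carlitzD F d / carlitzL F d ∧
    (carlitzE F d).coeff 2 =
      carlitzD F d * bracket F d ^ 2 / (bracket F 1 * carlitzL F d ^ 2) ∧
    (carlitzE F d).coeff 3 = 0 := by
  have := charP_two_K hq
  have h2 : (2 : K F) = 0 := CharTwo.two_eq_zero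
  have hb1 := bracket_ne_zero hq one_ne_zero
  induction d with
  | zero => simp [carlitzE, carlitzD, carlitzL_zero, bracket_zero, coeff_X]
  | succ d ih =>
    obtain ⟨h0, h1, h2', h3⟩ := ih
    have hL := carlitzL_ne_zero hq d
    have hD := carlitzD_ne_zero hq d
    have hb := bracket_ne_zero hq d.succ_ne_zero
    have hsq : ∀ k, (carlitzE F (d + 1)).coeff k = ∑ i ∈ Finset.range (k + 1),
        (carlitzE F d).coeff i * (carlitzE F d).coeff (k - i) +
          carlitzD F d * (carlitzE F d).coeff k := fun k => by
      rw [carlitzE, sq, coeff_add, coeff_C_mul, coeff_mul,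
        Finset.Nat.sum_antidiagonal_eq_sum_range_succ_mk]
    simp only [hsq, Finset.sum_range_succ, Finset.sum_range_zero, Nat.reduceSub, h0, h1, h2', h3,
      carlitzD, carlitzL_succ]
    refine ⟨by ring, ?_, ?_, ?_⟩
    · field_simp
      ring
    · have hs := bracket_add hq d 1
      field_simp
      rw [hs, pow_one]
      ring
    · linear_combination (carlitzD F d / carlitzL F d *
        (carlitzD F d * bracket F d ^ 2 / (bracket F 1 * carlitzL F d ^ 2))) * h2

variable [Finite F]

/-- The polynomials of degree less than `d` over the field with two elements. -/
def polysBelow (F : Type*) [Field F] [Finite F] : ℕ → Finset F[X]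
  | 0 => {0}
  | d + 1 => open scoped Classical in polysBelow F d ∪ monicsOfDegree F d

theorem mem_polysBelow (hq : Nat.card F = 2) {d : ℕ} {a : F[X]} :
    a ∈ polysBelow F d ↔ a.degree < d := by
  classical
  induction d with
  | zero => simp [polysBelow, Nat.WithBot.lt_zero_iff]
  | succ d ih =>
    rw [polysBelow, Finset.mem_union, ih, monicsOfDegree, Set.Finite.mem_toFinset,
      Set.mem_ofPred_eq]
    constructor
    · rintro (h | ⟨h, rfl⟩)
      · exact h.trans (by exact_mod_cast d.lt_succ_self)
      · exact degree_le_natDegree.trans_lt (by exact_mod_cast Nat.lt_succ_self _)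
    · intro h
      by_cases hd : a.degree < d
      · exact Or.inl hd
      · have h0 : a ≠ 0 := fun h0 => hd (by simp [h0])
        rw [degree_eq_natDegree h0] at h hd
        norm_cast at h hd
        refine Or.inr ⟨?_, by omega⟩
        exact (eq_zero_or_one_of_card hq _).resolve_left (leadingCoeff_ne_zero.2 h0)

/-- The monics of degree d are the translates by θ^d of the polynomials of smaller degree, so their
product is E_d(X + θ^d) = E_d + D_d. Multiplying by E_d gives the recursion for E_{d+1}. -/
theorem prod_polysBelow_add (hq : Nat.card F = 2) (d : ℕ) :
    ∏ a ∈ polysBelow F d, (X + C (algebraMap F[X] (K F) a)) = carlitzE F d ∧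
    ∏ a ∈ monicsOfDegree F d, (X + C (algebraMap F[X] (K F) a)) =
      carlitzE F d + C (carlitzD F d) := by
  classical
  have hmonic : ∀ d, ∏ a ∈ polysBelow F d, (X + C (algebraMap F[X] (K F) a)) = carlitzE F d →
      ∏ a ∈ monicsOfDegree F d, (X + C (algebraMap F[X] (K F) a)) =
      carlitzE F d + C (carlitzD F d) := by
    intro d h
    rw [← carlitzE_eval_theta_pow hq, ← carlitzE_comp_X_add_C hq, ← h, prod_comp]
    symm
    refine Finset.prod_bij (fun a _ => X ^ d + a) ?_ ?_ ?_ ?_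
    · intro a ha
      rw [mem_polysBelow hq] at ha
      rw [monicsOfDegree, Set.Finite.mem_toFinset]
      exact ⟨monic_X_pow_add ha, by rw [natDegree_add_eq_left_of_degree_lt (by rwa [degree_X_pow]), natDegree_X_pow]⟩
    · intro a _ b _ hab
      exact add_left_cancel hab
    · intro b hb
      rw [monicsOfDegree, Set.Finite.mem_toFinset] at hb
      obtain ⟨hb, rfl⟩ := hb
      refine ⟨b - X ^ b.natDegree, ?_, by ring⟩
      rw [mem_polysBelow hq, ← degree_eq_natDegree hb.ne_zero]
      exact degree_sub_lt_left (by rw [degree_X_pow, degree_eq_natDegree hb.ne_zero]) hb.ne_zero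
        (by rw [hb.leadingCoeff, (monic_X_pow _).leadingCoeff])
    · intro a _
      simp [theta, add_assoc]
  induction d with
  | zero =>
    have h0 : ∏ a ∈ polysBelow F 0, (X + C (algebraMap F[X] (K F) a)) = carlitzE F 0 := by
      simp [polysBelow, carlitzE]
    exact ⟨h0, hmonic 0 h0⟩
  | succ d ih =>
    have h : ∏ a ∈ polysBelow F (d + 1), (X + C (algebraMap F[X] (K F) a)) =
        carlitzE F (d + 1) := by
      rw [polysBelow, Finset.prod_union, ih.1, ih.2, carlitzE]
      · ring
      · rw [Finset.disjoint_left]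
        intro a ha hb
        rw [mem_polysBelow hq] at ha
        rw [monicsOfDegree, Set.Finite.mem_toFinset] at hb
        rw [degree_eq_natDegree hb.1.ne_zero, hb.2] at ha
        exact lt_irrefl _ ha
    exact ⟨h, hmonic _ h⟩

/-- Dividing E_d + D_d by its constant term D_d leaves ∏ (1 + X/a) over monic a of degree d. Its
coefficients, known from `carlitzE_coeff`, are the e_k of the inverses 1/a, with e₃ = 0. -/
theorem powerSum_one_and_three (hq : Nat.card F = 2) (d : ℕ) :
    powerSum F d 1 = 1 / carlitzL F d ∧
    powerSum F d 3 = 1 / carlitzL F d ^ 3 +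
      1 / carlitzL F d * (bracket F d ^ 2 / (bracket F 1 * carlitzL F d ^ 2)) := by
  have := charP_two_K hq
  have hD := carlitzD_ne_zero hq d
  obtain ⟨h0, h1, h3⟩ := sum_inv_and_sum_inv_cube_of_prod (monicsOfDegree F d)
    fun a => (algebraMap F[X] (K F) a)⁻¹
  have hprod : ∏ a ∈ monicsOfDegree F d, (X + C (algebraMap F[X] (K F) a)) =
      C (∏ a ∈ monicsOfDegree F d, algebraMap F[X] (K F) a) *
        ∏ a ∈ monicsOfDegree F d, (1 + C (algebraMap F[X] (K F) a)⁻¹ * X) := by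
    rw [map_prod, ← Finset.prod_mul_distrib]
    refine Finset.prod_congr rfl fun a ha => ?_
    rw [monicsOfDegree, Set.Finite.mem_toFinset] at ha
    have ha : algebraMap F[X] (K F) a ≠ 0 :=
      (map_ne_zero_iff _ (RatFunc.algebraMap_injective F)).2 ha.1.ne_zero
    rw [mul_add, mul_one, ← mul_assoc, ← C_mul, mul_inv_cancel₀ ha, C_1, one_mul, add_comm]
  rw [(prod_polysBelow_add hq d).2] at hprod
  obtain ⟨c0, c1, c2, c3⟩ := carlitzE_coeff hq d
  generalize ∏ a ∈ monicsOfDegree F d, (1 + C (algebraMap F[X] (K F) a)⁻¹ * X) = P at *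
  have e0 := congrArg (coeff · 0) hprod
  simp only [coeff_add, coeff_C_mul, coeff_C_zero, h0, c0, zero_add, mul_one] at e0
  rw [← e0] at hprod
  have e1 := congrArg (coeff · 1) hprod
  have e2 := congrArg (coeff · 2) hprod
  have e3 := congrArg (coeff · 3) hprod
  simp only [coeff_add, coeff_C_mul, coeff_C_succ, c1, c2, c3, add_zero] at e1 e2 e3
  have hL := carlitzL_ne_zero hq d
  have hb := bracket_ne_zero hq one_ne_zero
  replace e1 : P.coeff 1 = 1 / carlitzL F d := by
    field_simp at e1 ⊢
    linear_combination -e1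
  replace e2 : P.coeff 2 = bracket F d ^ 2 / (bracket F 1 * carlitzL F d ^ 2) := by
    refine mul_left_cancel₀ hD ?_
    rw [← e2, mul_div_assoc]
  replace e3 : P.coeff 3 = 0 := (mul_eq_zero.1 e3.symm).resolve_left hD
  constructor
  · rw [← e1, h1]
    simp [powerSum]
  · rw [e1, e2, e3, add_zero, one_div_pow] at h3
    rw [← h3]
    simp [powerSum]

theorem powerSum_two_mul (hq : Nat.card F = 2) (d s : ℕ) :
    powerSum F d (2 * s) = powerSum F d s ^ 2 := by
  have := charP_two_K hq
  rw [powerSum, powerSum, CharTwo.sum_sq]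
  refine Finset.sum_congr rfl fun a _ => ?_
  rw [div_pow, one_pow, ← pow_mul, mul_comm s]

end

/-! ### The coefficient c_r, and exact identities between truncated sums. -/

section

variable {F : Type*} [Field F]

/-- Identifies the product of powers of L_i in the denominator of `eulerCoeff` as D_{r-2}⁴. -/
theorem carlitzD_eq_prod (n : ℕ) :
    carlitzD F n = (∏ i ∈ Finset.Ico 1 n, carlitzL F i ^ 2 ^ (n - 1 - i)) * carlitzL F n := by
  induction n with
  | zero => simp [carlitzD, carlitzL_zero]
  | succ n ih =>
    rcases n.eq_zero_or_pos with rfl | hn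
    · simp [carlitzD, carlitzL_one]
    · rw [carlitzD, ih, Finset.prod_Ico_succ_top (by omega), mul_pow, ← Finset.prod_pow,
        carlitzL_succ, Nat.add_sub_cancel, Nat.sub_self, pow_zero, pow_one]
      have : ∀ i ∈ Finset.Ico 1 n,
          (carlitzL F i ^ 2 ^ (n - 1 - i)) ^ 2 = carlitzL F i ^ 2 ^ (n - i) := fun i hi => by
        have := Finset.mem_Ico.1 hi
        rw [← pow_mul, ← pow_succ]
        congr 2
        omega
      rw [Finset.prod_congr rfl this]
      ring

/-- Put r = n + 2. Since D_r = [r] D_{r-1}² and D_{r-1}² = [r-1]⁴ D_{r-2}⁴ / [r-1]², the claim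
reduces to [1]^{2^r} − [1][r] = ([r] − 1)[r-1]². Expanding [r+1] in two ways gives [1]^{2^r} = [r]²
+ [1] − [r], so the left side is ([r] − 1)([r] − [1]), and [r] − [1] = [r-1]². -/
theorem eulerCoeff_eq (hq : Nat.card F = 2) (n : ℕ) :
    eulerCoeff F (n + 2) = carlitzL F 1 ^ (2 ^ (n + 2) - 1) / carlitzD F (n + 2) -
      1 / carlitzD F (n + 1) ^ 2 := by
  have hprod : (∏ i ∈ Finset.Ico 1 n, carlitzL F i ^ 2 ^ (n + 1 - i)) * carlitzL F n ^ 2 ^ 2 =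
      carlitzD F n ^ 4 := by
    rw [carlitzD_eq_prod, mul_pow, ← Finset.prod_pow]
    congr 1
    refine Finset.prod_congr rfl fun i hi => ?_
    have := Finset.mem_Ico.1 hi
    rw [← pow_mul, show 4 = 2 ^ 2 from rfl, ← pow_add]
    congr 2
    omega
  have hD := carlitzD_ne_zero hq n
  have hb := bracket_ne_zero hq one_ne_zero
  have hb1 := bracket_ne_zero hq n.succ_ne_zero
  have hb2 := bracket_ne_zero hq (n + 1).succ_ne_zero
  have e1 := bracket_add hq (n + 1) 1
  have e2 := bracket_add hq (n + 2) 1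
  have e3 := bracket_add hq 1 (n + 2)
  rw [add_comm 1, e2] at e3
  have e4 : bracket F 1 ^ 2 ^ (n + 2) = bracket F 1 ^ (2 ^ (n + 2) - 1) * bracket F 1 := by
    rw [← pow_succ, Nat.sub_add_cancel Nat.one_le_two_pow]
  rw [eulerCoeff, show n + 2 - 2 = n from rfl, show n + 2 - 1 = n + 1 from rfl, hprod,
    carlitzL_one, carlitzD, carlitzD]
  rw [e4] at e3
  generalize bracket F 1 ^ (2 ^ (n + 2) - 1) = y at *
  simp only [Nat.succ_eq_add_one, add_assoc, Nat.reduceAdd, pow_one] at *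
  field_simp
  linear_combination e3 - (bracket F (n + 2) - 1) * e1

variable [Finite F]

theorem truncatedMZV_zero {n : ℕ} (s : Fin (n + 1) → ℕ) : truncatedMZV F s 0 = 0 := by
  simp [truncatedMZV]

theorem truncatedMZV_succ {n : ℕ} (s : Fin (n + 1) → ℕ) (N : ℕ) :
    truncatedMZV F s (N + 1) =
      truncatedMZV F s N + powerSum F N (s 0) * truncatedMZV F (Fin.tail s) N := by
  rw [truncatedMZV, Finset.sum_range_succ, truncatedMZV]

theorem truncatedMZV_two_mul (hq : Nat.card F = 2) {n : ℕ} (s : Fin n → ℕ) (N : ℕ) :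
    truncatedMZV F (fun i => 2 * s i) N = truncatedMZV F s N ^ 2 := by
  have := charP_two_K hq
  induction n generalizing N with
  | zero => simp [truncatedMZV]
  | succ n ih =>
    rw [truncatedMZV, truncatedMZV, CharTwo.sum_sq]
    refine Finset.sum_congr rfl fun d _ => ?_
    rw [powerSum_two_mul hq, mul_pow, ← ih (Fin.tail s)]
    rfl

theorem tail_tuplePow (n : ℕ) : Fin.tail (tuplePow (n + 1)) = fun i => 2 * tuplePow n i := by
  funext i
  simp [Fin.tail, tuplePow, pow_succ']

theorem tail_tupleOneOne (n : ℕ) : Fin.tail (tupleOneOne (n + 1)) = tuplePow n := by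
  funext i
  simp [Fin.tail, tuplePow, tupleOneOne]

theorem tail_tail_tupleThree (n : ℕ) :
    Fin.tail (Fin.tail (tupleThree (n + 2))) = fun i => 2 * (2 * tuplePow n i) := by
  funext i
  simp [Fin.tail, tuplePow, tupleThree, pow_succ']

theorem truncatedMZV_tuplePow_succ (hq : Nat.card F = 2) (n N : ℕ) :
    truncatedMZV F (tuplePow (n + 1)) (N + 1) = truncatedMZV F (tuplePow (n + 1)) N +
      1 / carlitzL F N * truncatedMZV F (tuplePow n) N ^ 2 := by
  rw [truncatedMZV_succ, tail_tuplePow, truncatedMZV_two_mul hq]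
  simp [tuplePow, (powerSum_one_and_three hq N).1]

theorem truncatedMZV_tupleOneOne_succ (hq : Nat.card F = 2) (n N : ℕ) :
    truncatedMZV F (tupleOneOne (n + 1)) (N + 1) = truncatedMZV F (tupleOneOne (n + 1)) N +
      1 / carlitzL F N * truncatedMZV F (tuplePow n) N := by
  rw [truncatedMZV_succ, tail_tupleOneOne]
  simp [tupleOneOne, (powerSum_one_and_three hq N).1]

theorem truncatedMZV_one_succ (hq : Nat.card F = 2) (N : ℕ) :
    truncatedMZV F ![1] (N + 1) = truncatedMZV F ![1] N + 1 / carlitzL F N := by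
  rw [truncatedMZV_succ]
  simp [truncatedMZV, (powerSum_one_and_three hq N).1]

theorem truncatedMZV_one (hq : Nat.card F = 2) (N : ℕ) :
    truncatedMZV F ![1] N = bracket F N ^ 2 / (bracket F 1 * carlitzL F N) := by
  have hb := bracket_ne_zero hq one_ne_zero
  induction N with
  | zero => simp [truncatedMZV_zero, bracket_zero]
  | succ N ih =>
    have hb1 := bracket_ne_zero hq N.succ_ne_zero
    have hL := carlitzL_ne_zero hq N
    rw [truncatedMZV_one_succ hq, ih, carlitzL_succ]
    have h := bracket_add hq N 1
    field_simp
    rw [h, pow_one]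

/-- The last factor is the depth one truncation at N + 1, so S_N(3) = S_N(2) ∑_{d ≤ N} S_d(1). This
is how the entry 3 becomes tied to a product with ζ(1). -/
theorem powerSum_three (hq : Nat.card F = 2) (N : ℕ) :
    powerSum F N 3 =
      (1 / carlitzL F N) ^ 2 * (truncatedMZV F ![1] N + 1 / carlitzL F N) := by
  have hb := bracket_ne_zero hq one_ne_zero
  have hL := carlitzL_ne_zero hq N
  rw [(powerSum_one_and_three hq N).2, truncatedMZV_one hq]
  field_simp
  ring

/-- The inner sum for (3, 4, 8, …), needed to run the induction for (1, 3, 4, …). In the inductive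
step S_N(1) times the square appears twice and cancels, and `powerSum_three` accounts for the rest.
-/
theorem truncatedMZV_tail_tupleThree (hq : Nat.card F = 2) (n N : ℕ) :
    truncatedMZV F (Fin.tail (tupleThree (n + 2))) N =
      truncatedMZV F ![1] N * truncatedMZV F (tuplePow (n + 1)) N ^ 2 +
        truncatedMZV F (tuplePow (n + 2)) N := by
  have := charP_two_K hq
  have h2 : (2 : K F) = 0 := CharTwo.two_eq_zero
  induction N with
  | zero => simp [truncatedMZV_zero]
  | succ N ih =>
    rw [truncatedMZV_succ, tail_tail_tupleThree, truncatedMZV_two_mul hq, truncatedMZV_two_mul hq,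
      ih, truncatedMZV_one_succ hq, truncatedMZV_tuplePow_succ hq, truncatedMZV_tuplePow_succ hq,
      show Fin.tail (tupleThree (n + 2)) 0 = 3 from rfl, powerSum_three hq]
    generalize truncatedMZV F ![1] N = A
    generalize truncatedMZV F (tuplePow (n + 1)) N = B
    generalize truncatedMZV F (tuplePow n) N = G
    generalize 1 / carlitzL F N = u
    linear_combination (-(A * B * u * G ^ 2) - u * B ^ 2 - u ^ 2 * B * G ^ 2) * h2

/-- Increments agree: with u = S_N(1), the increment of the left side is u times the inner sum of
`truncatedMZV_tail_tupleThree` plus the square of the increment for (1, 1, 2, …). The cross term of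
that square is even. -/
theorem truncatedMZV_relation (hq : Nat.card F = 2) (n N : ℕ) :
    truncatedMZV F ![1] N * truncatedMZV F (tuplePow (n + 2)) N =
      truncatedMZV F (tupleThree (n + 2)) N + truncatedMZV F (tupleOneOne (n + 2)) N ^ 2 := by
  have := charP_two_K hq
  have h2 : (2 : K F) = 0 := CharTwo.two_eq_zero
  induction N with
  | zero => simp [truncatedMZV_zero]
  | succ N ih =>
    rw [truncatedMZV_succ (tupleThree (n + 2)), truncatedMZV_tail_tupleThree hq,
      truncatedMZV_one_succ hq, truncatedMZV_tuplePow_succ hq, truncatedMZV_tupleOneOne_succ hq,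
      show tupleThree (n + 2) 0 = 1 from rfl, (powerSum_one_and_three hq N).1]
    linear_combination ih - (truncatedMZV F (tupleOneOne (n + 2)) N * (1 / carlitzL F N) *
      truncatedMZV F (tuplePow (n + 1)) N) * h2

/-- No strictly decreasing n-tuple lies below N < n, hence the shift by n. The induction on M closes
through [M+n+2] = [M+1]^{2^{n+1}} + [n+1]. -/
theorem truncatedMZV_tuplePow (hq : Nat.card F = 2) (n : ℕ) :
    (∀ N < n, truncatedMZV F (tuplePow n) N = 0) ∧
    ∀ M, truncatedMZV F (tuplePow n) (M + n) =
      carlitzL F (M + n) / (carlitzD F n * carlitzL F M ^ 2 ^ n) := by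
  induction n with
  | zero =>
    refine ⟨fun N hN => absurd hN N.not_lt_zero, fun M => ?_⟩
    have hL := carlitzL_ne_zero hq M
    simp [truncatedMZV, carlitzD, hL]
  | succ n ih =>
    obtain ⟨ih0, ih1⟩ := ih
    have hz : ∀ N ≤ n, truncatedMZV F (tuplePow (n + 1)) N = 0 := by
      intro N hN
      induction N with
      | zero => exact truncatedMZV_zero _
      | succ N ihN => simp [truncatedMZV_tuplePow_succ hq, ihN (by omega), ih0 N (by omega)]
    refine ⟨fun N hN => hz N (by omega), fun M => ?_⟩
    have hD := carlitzD_ne_zero hq n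
    have hb := bracket_ne_zero hq n.succ_ne_zero
    induction M with
    | zero =>
      have hL := carlitzL_ne_zero hq n
      have h := ih1 0
      rw [zero_add] at h
      rw [zero_add, truncatedMZV_tuplePow_succ hq, hz n le_rfl, h, carlitzL_zero, carlitzL_succ,
        carlitzD]
      field_simp
      simp
    | succ M ihM =>
      have hL := carlitzL_ne_zero hq M
      have hb1 := bracket_ne_zero hq M.succ_ne_zero
      have hL1 := carlitzL_ne_zero hq (M + 1 + n)
      have h := bracket_add hq (M + 1) (n + 1)
      rw [show M + 1 + (n + 1) = M + (n + 1) + 1 by omega, truncatedMZV_tuplePow_succ hq, ihM,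
        show M + (n + 1) = M + 1 + n by omega, ih1, carlitzL_succ (M + 1 + n), carlitzL_succ M,
        carlitzD, show M + 1 + n + 1 = M + 1 + (n + 1) by omega, h]
      simp only [mul_pow, pow_succ 2 n, pow_mul]
      field_simp

/-- By the preceding closed form each increment is (1/L_M)^{2^n}/D_n, the 2^n-th power of a depth
one increment, and Frobenius is additive. -/
theorem truncatedMZV_tupleOneOne (hq : Nat.card F = 2) (n M : ℕ) :
    truncatedMZV F (tupleOneOne (n + 1)) (M + n) =
      truncatedMZV F ![1] M ^ 2 ^ n / carlitzD F n := by
  have := charP_two_K hq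
  obtain ⟨h0, h1⟩ := truncatedMZV_tuplePow hq n
  have hD := carlitzD_ne_zero hq n
  induction M with
  | zero =>
    have : ∀ N ≤ n, truncatedMZV F (tupleOneOne (n + 1)) N = 0 := by
      intro N hN
      induction N with
      | zero => exact truncatedMZV_zero _
      | succ N ihN => simp [truncatedMZV_tupleOneOne_succ hq, ihN (by omega), h0 N (by omega)]
    simp [this n le_rfl, truncatedMZV_zero]
  | succ M ih =>
    have hL := carlitzL_ne_zero hq M
    have hL1 := carlitzL_ne_zero hq (M + n)
    rw [show M + 1 + n = M + n + 1 by omega, truncatedMZV_tupleOneOne_succ hq, ih, h1,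
      truncatedMZV_one_succ hq, add_pow_char_pow _ _ n (p := 2), one_div_pow]
    field_simp

theorem truncatedMZV_two_pow (hq : Nat.card F = 2) (n N : ℕ) :
    truncatedMZV F ![2 ^ n] N = truncatedMZV F ![1] N ^ 2 ^ n := by
  induction n with
  | zero => simp
  | succ n ih =>
    rw [pow_succ 2 n, pow_mul, ← ih, ← truncatedMZV_two_mul hq, mul_comm]
    congr 1
    funext i
    simp

end

/-! ### The Carlitz period and passage to the limit. -/

section

variable {F : Type*} [Field F]

theorem sum_tupleThree (n : ℕ) : ∑ i, tupleThree (n + 2) i = 2 ^ (n + 2) := by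
  have h : ∀ m : ℕ, ∑ i : Fin m, 2 ^ (i : ℕ) = 2 ^ m - 1 := fun m => by
    rw [Fin.sum_univ_eq_sum_range (fun i => 2 ^ i), Nat.geomSum_eq le_rfl, Nat.div_one]
  have h2 : ∑ i : Fin (n + 2), 2 ^ (i : ℕ) = 2 ^ (n + 2) - 1 := h _
  rw [Fin.sum_univ_succ, Fin.sum_univ_succ] at h2 ⊢
  simp only [tupleThree, Fin.val_zero, Fin.val_succ] at h2 ⊢
  have := Nat.one_le_two_pow (n := n + 2)
  simp at h2 ⊢
  omega

theorem tuplePow_pos {r : ℕ} (i : Fin r) : 0 < tuplePow r i := Nat.two_pow_pos _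

theorem tupleThree_pos {r : ℕ} (i : Fin r) : 0 < tupleThree r i := by
  rw [tupleThree]
  split_ifs <;> positivity

theorem tupleOneOne_pos {r : ℕ} (i : Fin r) : 0 < tupleOneOne r i := by
  rw [tupleOneOne]
  split_ifs <;> positivity

theorem tendsto_periodProduct :
    Tendsto (fun N => algebraMap (K F) (KInfty F) ((-theta F) ^ 2) *
      ∏ i ∈ Finset.range N, periodFactor F i) atTop (𝓝 (carlitzPeriodTwo F)) :=
  ((multipliable_periodFactor F).hasProd.tendsto_prod_nat).const_mul _

theorem theta_ne_zero : theta F ≠ 0 := RatFunc.X_ne_zero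

theorem periodProduct_eq (hq : Nat.card F = 2) (N : ℕ) :
    algebraMap (K F) (KInfty F) ((-theta F) ^ 2) * ∏ i ∈ Finset.range N, periodFactor F i =
      algebraMap (K F) (KInfty F) (theta F ^ 2 ^ (N + 1) / carlitzL F N) := by
  induction N with
  | zero => simp [carlitzL_zero]
  | succ N ih =>
    have hL := carlitzL_ne_zero hq N
    have hb := bracket_ne_zero hq N.succ_ne_zero
    have hθ := theta_ne_zero (F := F)
    rw [Finset.prod_range_succ, ← mul_assoc, ih, periodFactor, ← map_mul, carlitzL_succ]
    congr 1
    have h : 1 - theta F / theta F ^ 2 ^ (N + 1) =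
        bracket F (N + 1) / theta F ^ 2 ^ (N + 1) := by
      rw [bracket, hq]
      field_simp
    rw [h, pow_succ 2 (N + 1), pow_mul]
    field_simp

/-- Each factor has valuation 1, so all partial products have the valuation of θ² and cannot enter
the open unit ball around 0. -/
theorem carlitzPeriodTwo_ne_zero : carlitzPeriodTwo F ≠ 0 := by
  classical
  intro h0
  have hlim := tendsto_periodProduct (F := F)
  rw [h0] at hlim
  obtain ⟨N, hN⟩ := (hlim.eventually
    ((Valued.isOpen_ball (KInfty F) 1).mem_nhds (by simp))).exists
  have hlt : ∀ i : ℕ, (1 : ℤ) < 2 ^ (i + 1) := fun i => one_lt_pow₀ (by norm_num) i.succ_ne_zero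
  have hf : ∀ i, Valued.v (periodFactor F i) = 1 := fun i => by
    rw [periodFactor, valued_algebraMap, map_inv₀, Valuation.map_one_sub_of_lt, inv_one]
    rw [map_div₀, map_pow, theta, RatFunc.inftyValuation.X, ← WithZero.exp_nsmul,
      ← WithZero.exp_sub, ← WithZero.exp_zero, WithZero.exp_lt_exp]
    simpa using hlt i
  replace hN := (Valuation.restrict_lt_one_iff _).1 hN
  rw [map_mul, map_prod, Finset.prod_congr rfl fun i _ => hf i, Finset.prod_const_one,
    mul_one] at hN
  rw [valued_algebraMap, map_pow, Valuation.map_neg, theta, RatFunc.inftyValuation.X,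
    ← WithZero.exp_nsmul, ← WithZero.exp_zero, WithZero.exp_lt_exp] at hN
  norm_num at hN

variable [Finite F]

theorem tendsto_truncatedMZV_one :
    Tendsto (fun N => algebraMap (K F) (KInfty F) (truncatedMZV F ![1] N)) atTop
      (𝓝 (multizeta F ![1])) :=
  tendsto_truncatedMZV F (by simp)

/-- The N-th partial product is θ^{2^{N+1}}/L_N = ([N+1] + θ)/L_N. Here [N+1]/L_N = L_1
T_{(1)}(N+1), and the error θ/L_N is θ times an increment of a convergent sequence. -/
theorem carlitzPeriodTwo_eq (hq : Nat.card F = 2) :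
    carlitzPeriodTwo F = algebraMap (K F) (KInfty F) (carlitzL F 1) * multizeta F ![1] := by
  have h1 := tendsto_truncatedMZV_one (F := F)
  have h1' := h1.comp (tendsto_add_atTop_nat 1)
  have hinv := (h1'.sub h1).const_mul (algebraMap (K F) (KInfty F) (theta F))
  rw [sub_self, mul_zero] at hinv
  have h := (h1'.const_mul (algebraMap (K F) (KInfty F) (carlitzL F 1))).add hinv
  rw [add_zero] at h
  refine tendsto_nhds_unique tendsto_periodProduct (h.congr fun N => ?_)
  have hL := carlitzL_ne_zero hq N
  have hb := bracket_ne_zero hq N.succ_ne_zero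
  have hb1 := bracket_ne_zero hq one_ne_zero
  rw [periodProduct_eq hq]
  simp only [Function.comp_apply, ← map_mul, ← map_sub, ← map_add]
  congr 1
  have h' := truncatedMZV_one_succ hq N
  rw [h', add_sub_cancel_left, ← h', truncatedMZV_one hq, carlitzL_one, carlitzL_succ]
  have hbr : theta F ^ 2 ^ (N + 1) = bracket F (N + 1) + theta F := by simp [bracket, hq]
  rw [hbr]
  field_simp

/-- L_{M+1}/L_M² = L_1 T_{(1)}(M+1) tends to π̃. The general case telescopes:
L_{M+n+1}/L_M^{2^{n+1}} is the quotient for n at M + 1 times (L_{M+1}/L_M²)^{2^n}. -/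
theorem tendsto_carlitzL_div (hq : Nat.card F = 2) (n : ℕ) :
    Tendsto (fun M => algebraMap (K F) (KInfty F) (carlitzL F (M + n) / carlitzL F M ^ 2 ^ n))
      atTop (𝓝 (carlitzPeriodTwo F ^ (2 ^ n - 1))) := by
  induction n with
  | zero => simp [carlitzL_ne_zero hq]
  | succ n ih =>
    have h1 := (tendsto_truncatedMZV_one (F := F)).comp (tendsto_add_atTop_nat 1)
    have h1 := h1.const_mul (algebraMap (K F) (KInfty F) (carlitzL F 1))
    rw [← carlitzPeriodTwo_eq hq] at h1
    have h := (ih.comp (tendsto_add_atTop_nat 1)).mul (h1.pow (2 ^ n))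
    rw [← pow_add, show 2 ^ n - 1 + 2 ^ n = 2 ^ (n + 1) - 1 by
      have := Nat.one_le_two_pow (n := n)
      omega] at h
    refine h.congr fun M => ?_
    simp only [Function.comp_apply, ← map_mul, ← map_pow]
    congr 1
    have hL := carlitzL_ne_zero hq M
    have hb := bracket_ne_zero hq M.succ_ne_zero
    have hb1 := bracket_ne_zero hq one_ne_zero
    have e : carlitzL F 1 * truncatedMZV F ![1] (M + 1) =
        carlitzL F (M + 1) / carlitzL F M ^ 2 := by
      rw [truncatedMZV_one hq, carlitzL_one, carlitzL_succ]
      field_simp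
    rw [e, div_pow, ← pow_mul, ← pow_succ', show M + (n + 1) = M + 1 + n by omega]
    have := carlitzL_ne_zero hq (M + 1)
    field_simp

theorem multizeta_tuplePow (hq : Nat.card F = 2) (n : ℕ) :
    multizeta F (tuplePow n) =
      algebraMap (K F) (KInfty F) (1 / carlitzD F n) * carlitzPeriodTwo F ^ (2 ^ n - 1) := by
  refine tendsto_nhds_unique
    ((tendsto_truncatedMZV F tuplePow_pos).comp (tendsto_add_atTop_nat n))
    (((tendsto_carlitzL_div hq n).const_mul _).congr fun M => ?_)
  rw [Function.comp_apply, (truncatedMZV_tuplePow hq n).2, ← map_mul]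
  congr 1
  field_simp

theorem multizeta_tupleOneOne (hq : Nat.card F = 2) (n : ℕ) :
    multizeta F (tupleOneOne (n + 1)) =
      algebraMap (K F) (KInfty F) (1 / carlitzD F n) * multizeta F ![1] ^ 2 ^ n := by
  refine tendsto_nhds_unique
    ((tendsto_truncatedMZV F tupleOneOne_pos).comp (tendsto_add_atTop_nat n))
    (((tendsto_truncatedMZV_one.pow (2 ^ n)).const_mul _).congr fun M => ?_)
  rw [Function.comp_apply, truncatedMZV_tupleOneOne hq, ← map_pow, ← map_mul]
  congr 1
  field_simp

theorem multizeta_two_pow (hq : Nat.card F = 2) (n : ℕ) :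
    multizeta F ![2 ^ n] = multizeta F ![1] ^ 2 ^ n := by
  refine tendsto_nhds_unique (tendsto_truncatedMZV F (by simp))
    ((tendsto_truncatedMZV_one.pow (2 ^ n)).congr fun N => ?_)
  rw [truncatedMZV_two_pow hq, map_pow]

theorem multizeta_relation (hq : Nat.card F = 2) (n : ℕ) :
    multizeta F ![1] * multizeta F (tuplePow (n + 2)) =
      multizeta F (tupleThree (n + 2)) + multizeta F (tupleOneOne (n + 2)) ^ 2 := by
  refine tendsto_nhds_unique
    (tendsto_truncatedMZV_one.mul (tendsto_truncatedMZV F tuplePow_pos))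
    (((tendsto_truncatedMZV F tupleThree_pos).add
      ((tendsto_truncatedMZV F tupleOneOne_pos).pow 2)).congr fun N => ?_)
  rw [← map_mul, truncatedMZV_relation hq, map_add, map_pow]

theorem multizeta_tupleThree (hq : Nat.card F = 2) (n : ℕ) :
    multizeta F (tupleThree (n + 2)) =
      algebraMap (K F) (KInfty F) (eulerCoeff F (n + 2)) * multizeta F ![2 ^ (n + 2)] := by
  have h := multizeta_relation hq n
  rw [multizeta_tuplePow hq, multizeta_tupleOneOne hq] at h
  -- Everything becomes a multiple of ζ(1)^{2^r}, so only the two terms of `eulerCoeff_eq` need to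
  -- be matched.
  rw [eq_sub_iff_add_eq.2 h.symm, carlitzPeriodTwo_eq hq, multizeta_two_pow hq,
    eulerCoeff_eq hq]
  simp only [map_sub, map_div₀, map_pow, map_one]
  generalize algebraMap (K F) (KInfty F) (carlitzL F 1) = l
  have e : multizeta F ![1] ^ 2 ^ (n + 2) =
      multizeta F ![1] * multizeta F ![1] ^ (2 ^ (n + 2) - 1) := by
    rw [← pow_succ', Nat.sub_add_cancel Nat.one_le_two_pow]
  rw [sub_mul]
  congr 1
  · rw [e]
    ring
  · rw [pow_succ 2 (n + 1), pow_mul]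
    ring

end

end

end FunctionFieldMZV

open FunctionFieldMZV in
theorem theorem5p2 (Fq : Type*) [Field Fq] [Finite Fq] (hq : Nat.card Fq = 2)
    (r : ℕ) (hr : 1 < r) :
    -- the series and the product that define the values below converge
    (∀ (n : ℕ) (s : Fin n → ℕ), (∀ i, 0 < s i) → Summable (multizetaTerm Fq s)) ∧
    Multipliable (periodFactor Fq) ∧
    -- the relation
    multizeta Fq ![1] * multizeta Fq (tuplePow r) =
      multizeta Fq (tupleThree r) + multizeta Fq (tupleOneOne r) ^ 2 ∧
    -- the evaluation in terms of the period and in terms of the zeta value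
    multizeta Fq (tupleThree r) =
      algebraMap (K Fq) (KInfty Fq) (eulerCoeff Fq r * (1 / carlitzL Fq 1 ^ 2 ^ r)) *
        carlitzPeriodTwo Fq ^ 2 ^ r ∧
    multizeta Fq (tupleThree r) =
      algebraMap (K Fq) (KInfty Fq) (eulerCoeff Fq r) * multizeta Fq ![2 ^ r] ∧
    IsEulerianTwo Fq (tupleThree r) := by
  obtain ⟨n, rfl⟩ : ∃ n, r = n + 2 := ⟨r - 2, by omega⟩
  have hperiod : multizeta Fq (tupleThree (n + 2)) =
      algebraMap (K Fq) (KInfty Fq) (eulerCoeff Fq (n + 2) * (1 / carlitzL Fq 1 ^ 2 ^ (n + 2))) *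
        carlitzPeriodTwo Fq ^ 2 ^ (n + 2) := by
    have hl : algebraMap (K Fq) (KInfty Fq) (carlitzL Fq 1) ≠ 0 :=
      (map_ne_zero _).2 (carlitzL_ne_zero hq 1)
    rw [multizeta_tupleThree hq, multizeta_two_pow hq, carlitzPeriodTwo_eq hq, map_mul, mul_assoc,
      map_div₀, map_one, map_pow, mul_pow, ← mul_assoc (1 / _), one_div_mul_cancel (pow_ne_zero _ hl),
      one_mul]
  refine ⟨summable_multizetaTerm Fq, multipliable_periodFactor Fq, multizeta_relation hq n,
    hperiod, multizeta_tupleThree hq n,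
    eulerCoeff Fq (n + 2) * (1 / carlitzL Fq 1 ^ 2 ^ (n + 2)), ?_⟩
  rw [hperiod, sum_tupleThree, mul_div_cancel_right₀ _
    (pow_ne_zero _ (carlitzPeriodTwo_ne_zero))]
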